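/- Let $d\in\mathbb N$, $L>0$, let $f:\mathbb R^d\to\mathbb R$ be continuously differentiable with $\|\nabla f(x)-\nabla f(y)\|_2\le L\|x-y\|_2$ for all $x,y\in\mathbb R^d$, and let $g:\mathbb R^d\to\mathbb R\cup\{+\infty\}$ be proper, closed (lower semicontinuous) and convex. Put $F=f+g$, $\operatorname{dom}(F)=\{x: F(x)<+\infty\}$, and assume that $\mathcal X^*:=\operatorname{argmin}_x F(x)$ is nonempty and that $F^*:=\min_x F(x)$ is finite. For $\lambda>0$ let $$\operatorname{prox}_{\lambda g}(x)=\operatorname{argmin}_{y}\Big\{g(y)+\tfrac1{2\lambda}\|y-x\|_2^2\Big\},\qquad \mathcal G_\lambda(x)=\tfrac1\lambda\big(x-\operatorname{prox}_{\lambda g}(x-\lambda\nabla f(x))\big),$$ and for $x\in\operatorname{dom}(F)$ and $\alpha>0$ let $$\mathcal D_g(x,\alpha)=-2\alpha\min_{y\in\mathbb R^d}\Big[\langle\nabla f(x),y-x\rangle+\tfrac\alpha2\|y-x\|_2^2+g(y)-g(x)\Big].$$ For $\mathcal K\subseteq\mathbb R^d$, $F$ satisfies the $\mathcal K$-restricted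 proximal PL inequality with constant $\nu>0$ if $\frac12\mathcal D_g(x,L)\ge\nu\,(F(x)-F^*)$ for all $x\in\mathcal K\cap\operatorname{dom}(F)$, and the $\mathcal K$-restricted proximal error bound (EB) with constant $\mu>0$ if $\operatorname{dist}(x,\mathcal X^*)\le\mu\,\|\mathcal G_{1/L}(x)\|_2$ for all $x\in\mathcal K\cap\operatorname{dom}(F)$. **Theorem (Equivalence of restricted EB and PL).** Let $\mathcal K\subseteq\mathbb R^d$. (i) If $F$ satisfies the $\mathcal K$-restricted proximal EB with constant $\mu_{\mathcal K}>0$, then it satisfies the $\mathcal K$-restricted proximal PL inequality with constant $$\nu_{\mathcal K}=\frac{L}{1+4L^2\mu_{\mathcal K}^2}.$$ (ii) Conversely, suppose that $\mathcal K$ is closed and that for every $\lambda\in(0,1/L]$ the proximal gradient update $x\mapsto x-\lambda\,\mathcal G_\lambda(x)$ maps $\mathcal K$ into itself. If $F$ satisfies the $\mathcal K$-restricted proximal PL inequality with constant $\nu_{\mathcal K}>0$, then it satisfies the $\mathcal K$-restricted proximal EB with constant $$\mu_{\mathcal K}=\frac1L+\frac2{\nu_{\mathcal K}}.$$ -/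

import Mathlib

noncomputable section

namespace ProxPL

/-- The composite objective `F = f + g`, with values in the extended reals. -/
def objective {d : ℕ} (f : EuclideanSpace ℝ (Fin d) → ℝ)
    (g : EuclideanSpace ℝ (Fin d) → EReal) (x : EuclideanSpace ℝ (Fin d)) : EReal :=
  (f x : EReal) + g x

/-- The effective domain of `F`. -/
def effDom {d : ℕ} (f : EuclideanSpace ℝ (Fin d) → ℝ)
    (g : EuclideanSpace ℝ (Fin d) → EReal) : Set (EuclideanSpace ℝ (Fin d)) :=
  {x | objective f g x < ⊤}

/-- The optimal value `F^* = inf F`. -/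
def optValue {d : ℕ} (f : EuclideanSpace ℝ (Fin d) → ℝ)
    (g : EuclideanSpace ℝ (Fin d) → EReal) : EReal :=
  ⨅ x, objective f g x

/-- The optimal set `X^* = argmin F`. -/
def optSet {d : ℕ} (f : EuclideanSpace ℝ (Fin d) → ℝ)
    (g : EuclideanSpace ℝ (Fin d) → EReal) : Set (EuclideanSpace ℝ (Fin d)) :=
  {x | ∀ y, objective f g x ≤ objective f g y}

/-- The standing assumptions on the composite problem `min f + g`. -/
structure Regularity {d : ℕ} (f : EuclideanSpace ℝ (Fin d) → ℝ)
    (g : EuclideanSpace ℝ (Fin d) → EReal) (L : ℝ) : Prop where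
  /-- `f` is continuously differentiable. -/
  contDiff : ContDiff ℝ 1 f
  /-- `f` is `L`-smooth. -/
  smooth : ∀ x y, ‖gradient f x - gradient f y‖ ≤ L * ‖x - y‖
  /-- `g` takes values in `ℝ ∪ {+∞}`. -/
  ne_bot : ∀ x, g x ≠ ⊥
  /-- `g` is not identically `+∞`; together with `ne_bot`, `g` is proper. -/
  exists_ne_top : ∃ x, g x ≠ ⊤
  /-- `g` is closed. -/
  closed : LowerSemicontinuous g
  /-- `g` is convex: its epigraph is a convex set. -/
  convex : Convex ℝ {p : EuclideanSpace ℝ (Fin d) × ℝ | g p.1 ≤ (p.2 : EReal)}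
  /-- A minimizer of `F` exists. -/
  optSet_nonempty : (optSet f g).Nonempty
  /-- The optimal value is finite. -/
  optValue_finite : ∃ m : ℝ, optValue f g = (m : EReal)

/-- The proximal operator `prox_{lam g}(x)`: the minimizer of
`y ↦ g y + ‖y - x‖² / (2 lam)`. For `lam > 0` and `g` proper, closed and convex the minimizer
exists and is unique, so the choice made here is no choice. -/
def prox {d : ℕ} (lam : ℝ) (g : EuclideanSpace ℝ (Fin d) → EReal)
    (x : EuclideanSpace ℝ (Fin d)) : EuclideanSpace ℝ (Fin d) :=
  Classical.epsilon fun p => ∀ y,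
    g p + ((1 / (2 * lam) * ‖p - x‖ ^ 2 : ℝ) : EReal) ≤
      g y + ((1 / (2 * lam) * ‖y - x‖ ^ 2 : ℝ) : EReal)

/-- The proximal gradient mapping `𝒢_lam(x) = (x - prox_{lam g}(x - lam ∇f(x))) / lam`. -/
def gradMap {d : ℕ} (f : EuclideanSpace ℝ (Fin d) → ℝ)
    (g : EuclideanSpace ℝ (Fin d) → EReal) (lam : ℝ)
    (x : EuclideanSpace ℝ (Fin d)) : EuclideanSpace ℝ (Fin d) :=
  (1 / lam) • (x - prox lam g (x - lam • gradient f x))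

/-- The generalized gradient size
`𝒟_g(x, α) = -2α min_y [⟨∇f(x), y - x⟩ + (α/2)‖y - x‖² + g(y) - g(x)]`,
for `x` in the domain of `g`. -/
def genGradSize {d : ℕ} (f : EuclideanSpace ℝ (Fin d) → ℝ)
    (g : EuclideanSpace ℝ (Fin d) → EReal) (x : EuclideanSpace ℝ (Fin d)) (α : ℝ) : EReal :=
  ((-2 * α : ℝ) : EReal) *
    ⨅ y, (((inner ℝ (gradient f x) (y - x) + α / 2 * ‖y - x‖ ^ 2 : ℝ) : EReal) + (g y - g x))

/-- The `K`-restricted proximal PL inequality with constant `ν > 0`. -/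
def RestrictedPL {d : ℕ} (f : EuclideanSpace ℝ (Fin d) → ℝ)
    (g : EuclideanSpace ℝ (Fin d) → EReal) (L : ℝ)
    (K : Set (EuclideanSpace ℝ (Fin d))) (ν : ℝ) : Prop :=
  0 < ν ∧ ∀ x ∈ K ∩ effDom f g,
    (ν : EReal) * (objective f g x - optValue f g) ≤
      ((1 / 2 : ℝ) : EReal) * genGradSize f g x L

/-- The `K`-restricted proximal error bound with constant `μ > 0`. -/
def RestrictedEB {d : ℕ} (f : EuclideanSpace ℝ (Fin d) → ℝ)
    (g : EuclideanSpace ℝ (Fin d) → EReal) (L : ℝ)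
    (K : Set (EuclideanSpace ℝ (Fin d))) (μ : ℝ) : Prop :=
  0 < μ ∧ ∀ x ∈ K ∩ effDom f g,
    Metric.infDist x (optSet f g) ≤ μ * ‖gradMap f g (1 / L) x‖

/-- `K` is invariant under proximal gradient steps of every size `lam ∈ (0, 1/L]`. -/
def ProxGradInvariant {d : ℕ} (f : EuclideanSpace ℝ (Fin d) → ℝ)
    (g : EuclideanSpace ℝ (Fin d) → EReal) (L : ℝ)
    (K : Set (EuclideanSpace ℝ (Fin d))) : Prop :=
  ∀ lam ∈ Set.Ioc (0 : ℝ) (1 / L), Set.MapsTo (fun x => x - lam • gradMap f g lam x) K K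

end ProxPL

end

/-! Everything is expressed through the strongly convex model `m_α(y) = ⟨∇f(x), y - x⟩ + (α/2)‖y -
x‖² + g(y) - g(x)`, whose minimizer is the proximal gradient point with step `1/α`; PL bounds the
gap `F(x) - F^*` by a multiple of `-min m_L`.

EB to PL: evaluate `m_L` at the minimizer of `F` nearest to `x`. Since `f` lies above its concave
quadratic model, the gap is at most `-min m_L` plus `L` times the squared distance to `X^*`. EB
bounds that distance by the step length, and strong convexity bounds the squared step length by
`-min m_L`.

PL to EB: first derive quadratic growth, `(ν/2) dist² ≤ gap`, on `K`. Iterate proximal gradient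
steps with `α > L`. Each step lowers the square root of the gap in proportion to its length
(`mul_norm_step_le_sqrt_sub_sqrt`), so the path has finite length and ends at a minimizer
(`mul_infDist_le_sqrt`). The constant carries a factor `1 - L/α`, which tends to `1` as `α → ∞`,
that is, as the step size shrinks (`mul_infDist_sq_le`). Then apply growth and PL at the point `p`
one step of size `1/L` after `x`, where `-min m_L` is controlled by `‖x - p‖`
(`neg_model_step_step_le`), and conclude by the triangle inequality. -/

namespace ProxPL

/-! ### Smoothness bounds and a finite-length criterion -/

/-- Descent lemma: a function with `L`-Lipschitz gradient lies below its quadratic model. -/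
theorem le_add_inner_add_of_lipschitz_gradient {E : Type*} [NormedAddCommGroup E]
    [InnerProductSpace ℝ E] [CompleteSpace E] {f : E → ℝ} {L : ℝ} (hf : Differentiable ℝ f)
    (h : ∀ x y, ‖gradient f x - gradient f y‖ ≤ L * ‖x - y‖) (x y : E) :
    f y ≤ f x + inner ℝ (gradient f x) (y - x) + L / 2 * ‖y - x‖ ^ 2 := by
  set v := y - x with hv
  set φ : ℝ → ℝ := fun t => f (x + t • v) - t * inner ℝ (gradient f x) v
    - L / 2 * t ^ 2 * ‖v‖ ^ 2 with hφ
  have hd : ∀ t, HasDerivAt φ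
      (inner ℝ (gradient f (x + t • v)) v - inner ℝ (gradient f x) v - L * t * ‖v‖ ^ 2) t := by
    intro t
    have h1 : HasDerivAt (fun t : ℝ => x + t • v) v t := by
      simpa using ((hasDerivAt_id t).smul_const v).const_add x
    have h2 : HasDerivAt (fun t : ℝ => f (x + t • v)) (inner ℝ (gradient f (x + t • v)) v) t := by
      exact (hf (x + t • v)).hasGradientAt.hasFDerivAt.comp_hasDerivAt t h1
    have h4 : HasDerivAt (fun t : ℝ => t * inner ℝ (gradient f x) v)
        (inner ℝ (gradient f x) v) t := by
      simpa using (hasDerivAt_id t).mul_const (inner ℝ (gradient f x) v)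
    have h5 : HasDerivAt (fun t : ℝ => L / 2 * t ^ 2 * ‖v‖ ^ 2) (L * t * ‖v‖ ^ 2) t := by
      exact (((hasDerivAt_pow 2 t).const_mul (L / 2)).mul_const (‖v‖ ^ 2)).congr_deriv
        (by push_cast; ring)
    exact (h2.sub h4).sub h5
  -- By Cauchy–Schwarz and the Lipschitz bound the derivative is nonpositive; comparing `φ 1` with
  -- `φ 0` is the claim.
  have hanti : AntitoneOn φ (Set.Icc 0 1) := by
    refine antitoneOn_of_deriv_nonpos (convex_Icc 0 1)
      (fun t _ => (hd t).continuousAt.continuousWithinAt)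
      (fun t _ => (hd t).differentiableAt.differentiableWithinAt) fun t ht => ?_
    rw [interior_Icc] at ht
    rw [(hd t).deriv, ← inner_sub_left]
    have h1 := real_inner_le_norm (gradient f (x + t • v) - gradient f x) v
    have h2 := h (x + t • v) x
    rw [add_sub_cancel_left, norm_smul, Real.norm_of_nonneg ht.1.le] at h2
    have h3 := mul_le_mul_of_nonneg_right h2 (norm_nonneg v)
    linarith
  have h01 := hanti (Set.left_mem_Icc.2 zero_le_one) (Set.right_mem_Icc.2 zero_le_one) zero_le_one
  simp only [hφ] at h01
  have hy : x + v = y := by rw [hv]; abel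
  simp only [one_smul, zero_smul, add_zero, hy] at h01
  linarith

/-- A function with `L`-Lipschitz gradient lies above its concave quadratic model. -/
theorem add_inner_sub_le_of_lipschitz_gradient {E : Type*} [NormedAddCommGroup E]
    [InnerProductSpace ℝ E] [CompleteSpace E] {f : E → ℝ} {L : ℝ} (hf : Differentiable ℝ f)
    (h : ∀ x y, ‖gradient f x - gradient f y‖ ≤ L * ‖x - y‖) (x y : E) :
    f x + inner ℝ (gradient f x) (y - x) - L / 2 * ‖y - x‖ ^ 2 ≤ f y := by
  have hg : ∀ z, gradient (fun w => -f w) z = -gradient f z := fun z =>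
    HasGradientAt.gradient (by
      rw [hasGradientAt_iff_hasFDerivAt, map_neg]
      exact (hf z).hasGradientAt.hasFDerivAt.neg)
  have h1 := le_add_inner_add_of_lipschitz_gradient (f := fun w => -f w) (L := L) hf.neg
    (fun a b => by rw [hg, hg, neg_sub_neg, norm_sub_rev]; exact h a b) x y
  rw [hg, inner_neg_left] at h1
  linarith

/-- A sequence whose steps are controlled by the decrease of a nonnegative potential converges,
and its limit is within the initial potential of its starting point. -/
theorem exists_tendsto_of_mul_dist_le_sub {E : Type*} [MetricSpace E] [CompleteSpace E]
    {u : ℕ → E} {r : ℕ → ℝ} {c : ℝ} (hc : 0 < c) (hr : ∀ n, 0 ≤ r n)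
    (h : ∀ n, c * dist (u n) (u (n + 1)) ≤ r n - r (n + 1)) :
    ∃ a, Filter.Tendsto u Filter.atTop (nhds a) ∧ c * dist (u 0) a ≤ r 0 := by
  have hsum : ∀ n, ∑ i ∈ Finset.range n, dist (u i) (u (i + 1)) ≤ r 0 / c := by
    intro n
    rw [le_div_iff₀' hc, Finset.mul_sum]
    calc ∑ i ∈ Finset.range n, c * dist (u i) (u (i + 1))
        ≤ ∑ i ∈ Finset.range n, (r i - r (i + 1)) := Finset.sum_le_sum fun i _ => h i
      _ = r 0 - r n := Finset.sum_range_sub' r n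
      _ ≤ r 0 := by linarith [hr n]
  have hs : Summable fun n => dist (u n) (u n.succ) :=
    summable_of_sum_range_le (fun _ => dist_nonneg) hsum
  obtain ⟨a, ha⟩ := cauchySeq_tendsto_of_complete (cauchySeq_of_summable_dist hs)
  refine ⟨a, ha, ?_⟩
  have h1 := dist_le_tsum_of_dist_le_of_tendsto₀ _ (fun n => le_rfl) hs ha
  have h2 := Real.tsum_le_of_sum_range_le (fun _ => dist_nonneg) hsum
  rw [← le_div_iff₀' hc]
  exact h1.trans h2

/-! ### Existence and optimality condition of the proximal point -/

variable {d : ℕ} {f : EuclideanSpace ℝ (Fin d) → ℝ} {g : EuclideanSpace ℝ (Fin d) → EReal}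
  {L : ℝ}

namespace Regularity

theorem coe_toReal (hF : Regularity f g L) {x : EuclideanSpace ℝ (Fin d)} (hx : g x ≠ ⊤) :
    ((g x).toReal : EReal) = g x :=
  EReal.coe_toReal hx (hF.ne_bot x)

theorem segment (hF : Regularity f g L) {x y : EuclideanSpace ℝ (Fin d)} (hx : g x ≠ ⊤)
    (hy : g y ≠ ⊤) {t : ℝ} (ht0 : 0 ≤ t) (ht1 : t ≤ 1) :
    g (x + t • (y - x)) ≠ ⊤ ∧
      (g (x + t • (y - x))).toReal ≤ (1 - t) * (g x).toReal + t * (g y).toReal := by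
  have hmem := hF.convex (x := (x, (g x).toReal)) (y := (y, (g y).toReal))
    (by simp [hF.coe_toReal hx]) (by simp [hF.coe_toReal hy])
    (sub_nonneg.2 ht1) ht0 (by ring)
  have he : (1 - t) • x + t • y = x + t • (y - x) := by module
  simp only [Set.mem_ofPred_eq, Prod.smul_mk, Prod.mk_add_mk, smul_eq_mul, he] at hmem
  have hne : g (x + t • (y - x)) ≠ ⊤ := fun h => by
    rw [h] at hmem
    exact EReal.coe_ne_top _ (top_le_iff.1 hmem)
  refine ⟨hne, ?_⟩
  rw [← hF.coe_toReal hne] at hmem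
  exact_mod_cast hmem

/-- Convexity and lower semicontinuity give a lower bound that is linear in the distance. -/
theorem exists_linear_lower_bound (hF : Regularity f g L) {z : EuclideanSpace ℝ (Fin d)}
    (hz : g z ≠ ⊤) : ∃ b : ℝ, 0 ≤ b ∧ ∀ y, g y ≠ ⊤ → 1 ≤ ‖y - z‖ →
      (g z).toReal - b * ‖y - z‖ ≤ (g y).toReal := by
  obtain ⟨p, hp, hmin⟩ := LowerSemicontinuousOn.exists_isMinOn (f := g)
    (s := Metric.closedBall z 1) ⟨z, by simp⟩ (isCompact_closedBall z 1)
    (hF.closed.lowerSemicontinuousOn _)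
  have hmin' : ∀ y ∈ Metric.closedBall z 1, g p ≤ g y := fun y hy => hmin hy
  have hpz : g p ≤ g z := hmin' z (by simp)
  have hpt : g p ≠ ⊤ := ne_top_of_le_ne_top hz hpz
  refine ⟨(g z).toReal - (g p).toReal,
    sub_nonneg.2 (EReal.toReal_le_toReal hpz (hF.ne_bot p) hz), fun y hy h1 => ?_⟩
  have hpos : 0 < ‖y - z‖ := by linarith
  -- This `t` places the point of the segment on the unit sphere around `z`, where `g` is at least
  -- `g p`.
  obtain ⟨hq, hle⟩ := hF.segment hz hy (t := ‖y - z‖⁻¹) (by positivity) (inv_le_one_of_one_le₀ h1)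
  have hball : z + ‖y - z‖⁻¹ • (y - z) ∈ Metric.closedBall z 1 := by
    rw [mem_closedBall_iff_norm, add_sub_cancel_left, norm_smul, norm_inv, norm_norm,
      inv_mul_cancel₀ hpos.ne']
  have h2 := EReal.toReal_le_toReal (hmin' _ hball) (hF.ne_bot p) hq
  have h3 := mul_le_mul_of_nonneg_left (h2.trans hle) hpos.le
  have h4 : ‖y - z‖ * ((1 - ‖y - z‖⁻¹) * (g z).toReal + ‖y - z‖⁻¹ * (g y).toReal)
      = ‖y - z‖ * (g z).toReal - (g z).toReal + (g y).toReal := by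
    field_simp
  nlinarith

/-- The quadratic dominates the linear lower bound on `g` far from `z`, so a minimizer over a large
compact ball is global. -/
theorem exists_prox (hF : Regularity f g L) {c : ℝ} (hc : 0 < c)
    (x : EuclideanSpace ℝ (Fin d)) :
    ∃ p, ∀ y, g p + ((c * ‖p - x‖ ^ 2 : ℝ) : EReal) ≤ g y + ((c * ‖y - x‖ ^ 2 : ℝ) : EReal) := by
  obtain ⟨z, hz⟩ := hF.exists_ne_top
  obtain ⟨b, hb, hlow⟩ := hF.exists_linear_lower_bound hz
  have hlsc : LowerSemicontinuous
      fun y => g y + ((c * ‖y - x‖ ^ 2 : ℝ) : EReal) := by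
    refine LowerSemicontinuous.add' hF.closed ?_ fun y =>
      EReal.continuousAt_add (.inr (EReal.coe_ne_bot _)) (.inr (EReal.coe_ne_top _))
    exact (continuous_coe_real_ereal.comp (by fun_prop)).lowerSemicontinuous
  -- For `‖y - z‖ > R` one has `b ≤ c (‖y - z‖ - 2‖z - x‖)`, which makes the value at `y` at least
  -- the value at `z`.
  set R : ℝ := 1 + 2 * ‖z - x‖ + b / c with hR
  have hbc : 0 ≤ b / c := by positivity
  have hD := norm_nonneg (z - x)
  obtain ⟨p, hp, hmin⟩ := LowerSemicontinuousOn.exists_isMinOn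
    (s := Metric.closedBall z R) ⟨z, Metric.mem_closedBall_self (by linarith)⟩
    (isCompact_closedBall z R) (hlsc.lowerSemicontinuousOn _)
  have hmin' : ∀ y ∈ Metric.closedBall z R, g p + ((c * ‖p - x‖ ^ 2 : ℝ) : EReal)
    ≤ g y + ((c * ‖y - x‖ ^ 2 : ℝ) : EReal) := fun y hy => hmin hy
  refine ⟨p, fun y => ?_⟩
  by_cases hy : y ∈ Metric.closedBall z R
  · exact hmin' y hy
  refine (hmin' z (Metric.mem_closedBall_self (by linarith))).trans ?_
  by_cases hgy : g y = ⊤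
  · rw [hgy, EReal.top_add_coe]
    exact le_top
  rw [mem_closedBall_iff_norm, not_le] at hy
  have h1 := hlow y hgy (by linarith)
  rw [← hF.coe_toReal hz, ← hF.coe_toReal hgy]
  norm_cast
  have h2 : ‖y - z‖ - ‖z - x‖ ≤ ‖y - x‖ := by
    have := norm_sub_le (y - x) (z - x)
    rw [sub_sub_sub_cancel_right] at this
    linarith
  have h3 : (‖y - z‖ - ‖z - x‖) ^ 2 ≤ ‖y - x‖ ^ 2 :=
    pow_le_pow_left₀ (by linarith) h2 2
  have h4 := mul_le_mul_of_nonneg_left h3 hc.le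
  have h5 : b ≤ c * (‖y - z‖ - 2 * ‖z - x‖) := by
    rw [← div_le_iff₀' hc]; linarith
  have h6 := mul_le_mul_of_nonneg_right h5 (norm_nonneg (y - z))
  nlinarith

theorem prox_spec (hF : Regularity f g L) {lam : ℝ} (hlam : 0 < lam)
    (x y : EuclideanSpace ℝ (Fin d)) :
    g (prox lam g x) + ((1 / (2 * lam) * ‖prox lam g x - x‖ ^ 2 : ℝ) : EReal) ≤
      g y + ((1 / (2 * lam) * ‖y - x‖ ^ 2 : ℝ) : EReal) :=
  Classical.epsilon_spec (hF.exists_prox (c := 1 / (2 * lam)) (by positivity) x) y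

theorem prox_ne_top (hF : Regularity f g L) {lam : ℝ} (hlam : 0 < lam)
    (x : EuclideanSpace ℝ (Fin d)) : g (prox lam g x) ≠ ⊤ := by
  obtain ⟨z, hz⟩ := hF.exists_ne_top
  intro h
  have h1 := hF.prox_spec hlam x z
  rw [h, EReal.top_add_coe, top_le_iff, ← hF.coe_toReal hz, ← EReal.coe_add] at h1
  exact EReal.coe_ne_top _ h1

/-- The optimality condition of the proximal step: `(x - p) / lam` is a subgradient of `g` at
`p = prox lam g x`. -/
theorem prox_subgradient (hF : Regularity f g L) {lam : ℝ} (hlam : 0 < lam)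
    (x : EuclideanSpace ℝ (Fin d)) {y : EuclideanSpace ℝ (Fin d)} (hy : g y ≠ ⊤) :
    (g (prox lam g x)).toReal + 1 / lam * inner ℝ (x - prox lam g x) (y - prox lam g x)
      ≤ (g y).toReal := by
  have hp := hF.prox_ne_top hlam x
  have hspec := hF.prox_spec hlam x
  set p := prox lam g x
  -- Minimality of `p` is tested at `p + t (y - p)` and divided by `t`; the remaining error is
  -- linear in `t` and vanishes as `t → 0`.
  have key : ∀ t ∈ Set.Ioc (0 : ℝ) 1, (g p).toReal + 1 / lam * inner ℝ (x - p) (y - p)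
      ≤ (g y).toReal + t * (1 / (2 * lam) * ‖y - p‖ ^ 2) := by
    intro t ht
    obtain ⟨hne, hle⟩ := hF.segment hp hy ht.1.le ht.2
    have h1 := hspec (p + t • (y - p))
    rw [← hF.coe_toReal hp, ← hF.coe_toReal hne] at h1
    norm_cast at h1
    have h2 : ‖p + t • (y - p) - x‖ ^ 2
        = ‖p - x‖ ^ 2 - 2 * t * inner ℝ (x - p) (y - p) + t ^ 2 * ‖y - p‖ ^ 2 := by
      have : p + t • (y - p) - x = (p - x) + t • (y - p) := by abel
      rw [this, norm_add_sq_real, inner_smul_right, norm_smul, mul_pow, Real.norm_eq_abs, sq_abs,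
        ← neg_sub x p, inner_neg_left, norm_neg]
      ring
    rw [h2] at h1
    have h3 : 1 / lam = 2 * (1 / (2 * lam)) := by field_simp
    rw [h3]
    have h4 := ht.1
    refine le_of_mul_le_mul_left ?_ h4
    nlinarith
  have hlim : Filter.Tendsto (fun t : ℝ => (g y).toReal + t * (1 / (2 * lam) * ‖y - p‖ ^ 2))
      (nhdsWithin 0 (Set.Ioi 0)) (nhds ((g y).toReal + 0 * (1 / (2 * lam) * ‖y - p‖ ^ 2))) :=
    Filter.Tendsto.mono_left (Continuous.tendsto (by fun_prop) 0) nhdsWithin_le_nhds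
  rw [zero_mul, add_zero] at hlim
  refine ge_of_tendsto hlim ?_
  filter_upwards [Ioc_mem_nhdsGT (zero_lt_one' ℝ)] with t ht using key t ht

end Regularity

/-! ### The proximal gradient step and its model -/

/-- The proximal gradient update with step size `1 / α`. -/
noncomputable def step {d : ℕ} (f : EuclideanSpace ℝ (Fin d) → ℝ)
    (g : EuclideanSpace ℝ (Fin d) → EReal) (α : ℝ) (x : EuclideanSpace ℝ (Fin d)) :
    EuclideanSpace ℝ (Fin d) :=
  prox (1 / α) g (x - (1 / α) • gradient f x)

/-- The real-valued proximal model minimized by the proximal gradient update. -/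
noncomputable def model {d : ℕ} (f : EuclideanSpace ℝ (Fin d) → ℝ)
    (g : EuclideanSpace ℝ (Fin d) → EReal) (α : ℝ) (x y : EuclideanSpace ℝ (Fin d)) : ℝ :=
  inner ℝ (gradient f x) (y - x) + α / 2 * ‖y - x‖ ^ 2 + ((g y).toReal - (g x).toReal)

/-- The objective as a real number, meaningful on the effective domain. -/
noncomputable def realObjective {d : ℕ} (f : EuclideanSpace ℝ (Fin d) → ℝ)
    (g : EuclideanSpace ℝ (Fin d) → EReal) (x : EuclideanSpace ℝ (Fin d)) : ℝ :=
  f x + (g x).toReal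

variable {α : ℝ} {x y : EuclideanSpace ℝ (Fin d)}

theorem sub_smul_gradMap {lam : ℝ} (hlam : lam ≠ 0) (x : EuclideanSpace ℝ (Fin d)) :
    x - lam • gradMap f g lam x = step f g (1 / lam) x := by
  rw [gradMap, step, smul_smul, mul_one_div_cancel hlam, one_smul, sub_sub_cancel, one_div_one_div]

theorem norm_gradMap_one_div (hL : 0 < L) (x : EuclideanSpace ℝ (Fin d)) :
    ‖gradMap f g (1 / L) x‖ = L * ‖x - step f g L x‖ := by
  rw [gradMap, one_div_one_div, norm_smul, Real.norm_of_nonneg hL.le, step]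

theorem mem_effDom_iff : x ∈ effDom f g ↔ g x ≠ ⊤ := by
  change (f x : EReal) + g x < ⊤ ↔ _
  rw [lt_top_iff_ne_top, not_iff_not]
  induction g x using EReal.rec with
  | bot => simp
  | coe r => simp [← EReal.coe_add]
  | top => simp

namespace Regularity

theorem differentiable (hF : Regularity f g L) : Differentiable ℝ f :=
  hF.contDiff.differentiable (by norm_num)

theorem step_ne_top (hF : Regularity f g L) (hα : 0 < α) (x : EuclideanSpace ℝ (Fin d)) :
    g (step f g α x) ≠ ⊤ :=
  hF.prox_ne_top (by positivity) _

theorem step_subgradient (hF : Regularity f g L) (hα : 0 < α) (x : EuclideanSpace ℝ (Fin d))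
    (hy : g y ≠ ⊤) :
    (g (step f g α x)).toReal
      + (α * inner ℝ (x - step f g α x) (y - step f g α x)
        - inner ℝ (gradient f x) (y - step f g α x)) ≤ (g y).toReal := by
  have h := hF.prox_subgradient (lam := 1 / α) (by positivity) (x - (1 / α) • gradient f x) hy
  change (g (step f g α x)).toReal + 1 / (1 / α) * inner ℝ (x - (1 / α) • gradient f x
    - step f g α x) (y - step f g α x) ≤ _ at h
  rw [sub_right_comm, inner_sub_left, inner_smul_left, one_div_one_div, mul_sub] at h
  simpa [mul_inv_cancel_left₀ hα.ne'] using h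

/-- The model is `α`-strongly convex and the step minimizes it, hence the quadratic surplus. -/
theorem model_step_add_le (hF : Regularity f g L) (hα : 0 < α) (x : EuclideanSpace ℝ (Fin d))
    (hy : g y ≠ ⊤) :
    model f g α x (step f g α x) + α / 2 * ‖y - step f g α x‖ ^ 2 ≤ model f g α x y := by
  have h := hF.step_subgradient hα x hy
  set p := step f g α x
  have h1 : inner ℝ (gradient f x) (y - x)
      = inner ℝ (gradient f x) (y - p) + inner ℝ (gradient f x) (p - x) := by
    rw [← inner_add_right, sub_add_sub_cancel]
  have h2 : ‖y - x‖ ^ 2 = ‖y - p‖ ^ 2 - 2 * inner ℝ (x - p) (y - p) + ‖p - x‖ ^ 2 := by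
    rw [← sub_sub_sub_cancel_right y x p, norm_sub_sq_real, real_inner_comm, norm_sub_rev x p]
  simp only [model, h1, h2]
  linarith

/-- Sufficient decrease in the model. -/
theorem norm_sq_le_neg_model_step (hF : Regularity f g L) (hα : 0 < α) (hx : g x ≠ ⊤) :
    α / 2 * ‖x - step f g α x‖ ^ 2 ≤ -model f g α x (step f g α x) := by
  have h := hF.model_step_add_le hα x hx
  have h0 : model f g α x x = 0 := by simp [model]
  linarith

/-- The descent lemma needs curvature only `L`; for `α > L` the surplus `α - L` gives extra decrease
in the step length. -/
theorem realObjective_step_le (hF : Regularity f g L) (x : EuclideanSpace ℝ (Fin d)) (α : ℝ) :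
    realObjective f g (step f g α x) ≤ realObjective f g x + model f g α x (step f g α x)
      - (α - L) / 2 * ‖x - step f g α x‖ ^ 2 := by
  have h := le_add_inner_add_of_lipschitz_gradient hF.differentiable hF.smooth x (step f g α x)
  rw [norm_sub_rev x]
  simp only [realObjective, model]
  linarith

/-- The scaled model value is monotone in the curvature parameter. -/
theorem mul_model_step_le (hF : Regularity f g L) {β : ℝ} (hβ : 0 < β) (hβα : β ≤ α)
    (hx : g x ≠ ⊤) :
    α * model f g α x (step f g α x) ≤ β * model f g β x (step f g β x) := by
  have hα : 0 < α := hβ.trans_le hβα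
  have hz := hF.step_ne_top hβ x
  set z := step f g β x
  -- Shrinking the `β`-step by `β / α` gives a test point whose quadratic term scales exactly: `α ·
  -- (α/2)(β/α)² = β · (β/2)`.
  obtain ⟨hne, hle⟩ := hF.segment hx hz (t := β / α) (by positivity) ((div_le_one hα).2 hβα)
  have h1 := hF.model_step_add_le hα x hne
  have h2 : 0 ≤ α / 2 * ‖x + (β / α) • (z - x) - step f g α x‖ ^ 2 := by positivity
  refine (mul_le_mul_of_nonneg_left (by linarith) hα.le).trans (?_ : α * model f g α x
    (x + (β / α) • (z - x)) ≤ _)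
  simp only [model, add_sub_cancel_left, inner_smul_right, norm_smul, mul_pow, Real.norm_eq_abs,
    sq_abs]
  have h3 := mul_le_mul_of_nonneg_left hle hα.le
  have h4 : α * ((1 - β / α) * (g x).toReal + β / α * (g z).toReal)
      = α * (g x).toReal + β * ((g z).toReal - (g x).toReal) := by field_simp; ring
  have h5 : α * (β / α * inner ℝ (gradient f x) (z - x)
      + α / 2 * ((β / α) ^ 2 * ‖z - x‖ ^ 2))
      = β * inner ℝ (gradient f x) (z - x) + β * (β / 2 * ‖z - x‖ ^ 2) := by field_simp
  linarith

theorem genGradSize_eq (hF : Regularity f g L) (hα : 0 < α) (hx : g x ≠ ⊤) :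
    genGradSize f g x α = ((-2 * α * model f g α x (step f g α x) : ℝ) : EReal) := by
  have hterm : ∀ y, g y ≠ ⊤ →
      ((inner ℝ (gradient f x) (y - x) + α / 2 * ‖y - x‖ ^ 2 : ℝ) : EReal) + (g y - g x)
        = (model f g α x y : EReal) := by
    intro y hy
    rw [← hF.coe_toReal hx, ← hF.coe_toReal hy, ← EReal.coe_sub, ← EReal.coe_add]
    rfl
  rw [genGradSize, EReal.coe_mul (-2 * α) (model f g α x (step f g α x))]
  congr 1
  refine le_antisymm ((iInf_le _ (step f g α x)).trans_eq (hterm _ (hF.step_ne_top hα x)))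
    (le_iInf fun y => ?_)
  by_cases hy : g y = ⊤
  · rw [hy, ← hF.coe_toReal hx, EReal.top_sub_coe, EReal.coe_add_top]
    exact le_top
  · rw [hterm y hy, EReal.coe_le_coe_iff]
    have h1 := hF.model_step_add_le hα x hy
    have h2 : 0 ≤ α / 2 * ‖y - step f g α x‖ ^ 2 := by positivity
    linarith

theorem objective_eq (hF : Regularity f g L) (hx : g x ≠ ⊤) :
    objective f g x = (realObjective f g x : EReal) := by
  rw [objective, realObjective, EReal.coe_add, hF.coe_toReal hx]

theorem ne_top_of_mem_optSet (hF : Regularity f g L) (hx : x ∈ optSet f g) : g x ≠ ⊤ := by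
  obtain ⟨z, hz⟩ := hF.exists_ne_top
  rw [← mem_effDom_iff (f := f)] at hz ⊢
  exact (hx z).trans_lt hz

theorem optValue_eq (hF : Regularity f g L) (hx : x ∈ optSet f g) :
    optValue f g = (realObjective f g x : EReal) := by
  rw [← hF.objective_eq (hF.ne_top_of_mem_optSet hx)]
  exact le_antisymm (iInf_le _ x) (le_iInf hx)

theorem realObjective_le (hF : Regularity f g L) (hx : x ∈ optSet f g) (hy : g y ≠ ⊤) :
    realObjective f g x ≤ realObjective f g y := by
  have h := hx y
  rw [hF.objective_eq (hF.ne_top_of_mem_optSet hx), hF.objective_eq hy] at h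
  exact_mod_cast h

/-- Moves PL from extended to real arithmetic, with any minimizer supplying the optimal value. -/
theorem restrictedPL_iff (hF : Regularity f g L) (hL : 0 < L)
    {K : Set (EuclideanSpace ℝ (Fin d))} {ν : ℝ} {xs : EuclideanSpace ℝ (Fin d)}
    (hxs : xs ∈ optSet f g) :
    RestrictedPL f g L K ν ↔ 0 < ν ∧ ∀ x ∈ K, g x ≠ ⊤ →
      ν * (realObjective f g x - realObjective f g xs) ≤ -(L * model f g L x (step f g L x)) := by
  refine and_congr_right fun _ => ⟨fun h x hx hgx => ?_, fun h x hx => ?_⟩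
  · have h1 := h x ⟨hx, mem_effDom_iff.2 hgx⟩
    rw [hF.objective_eq hgx, hF.optValue_eq hxs, hF.genGradSize_eq hL hgx,
      ← EReal.coe_sub, ← EReal.coe_mul, ← EReal.coe_mul, EReal.coe_le_coe_iff] at h1
    linarith
  · have hgx := mem_effDom_iff.1 hx.2
    have h1 := h x hx.1 hgx
    rw [hF.objective_eq hgx, hF.optValue_eq hxs, hF.genGradSize_eq hL hgx,
      ← EReal.coe_sub, ← EReal.coe_mul, ← EReal.coe_mul, EReal.coe_le_coe_iff]
    linarith

theorem lowerSemicontinuous_objective (hF : Regularity f g L) :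
    LowerSemicontinuous (objective f g) :=
  LowerSemicontinuous.add'
    (continuous_coe_real_ereal.comp hF.contDiff.continuous).lowerSemicontinuous hF.closed
    fun _ => EReal.continuousAt_add (.inl (EReal.coe_ne_top _)) (.inl (EReal.coe_ne_bot _))

theorem isClosed_optSet (hF : Regularity f g L) : IsClosed (optSet f g) := by
  have h : optSet f g = objective f g ⁻¹' Set.Iic (optValue f g) := by
    ext x
    exact (le_iInf_iff (f := objective f g)).symm
  rw [h]
  exact hF.lowerSemicontinuous_objective.isClosed_preimage _

/-! ### Error bound implies PL -/

theorem restrictedPL_of_restrictedEB (hF : Regularity f g L) (hL : 0 < L)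
    {K : Set (EuclideanSpace ℝ (Fin d))} {μ : ℝ} (hEB : RestrictedEB f g L K μ) :
    RestrictedPL f g L K (L / (1 + 4 * L ^ 2 * μ ^ 2)) := by
  obtain ⟨x₀, hx₀⟩ := hF.optSet_nonempty
  rw [hF.restrictedPL_iff hL hx₀]
  refine ⟨by positivity, fun x hxK hx => ?_⟩
  obtain ⟨xs, hxs, hdist⟩ := hF.isClosed_optSet.exists_infDist_eq_dist ⟨x₀, hx₀⟩ x
  have hval : realObjective f g x₀ = realObjective f g xs :=
    le_antisymm (hF.realObjective_le hx₀ (hF.ne_top_of_mem_optSet hxs))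
      (hF.realObjective_le hxs (hF.ne_top_of_mem_optSet hx₀))
  have heb := hEB.2 x ⟨hxK, mem_effDom_iff.2 hx⟩
  rw [hdist, norm_gradMap_one_div hL, dist_comm, dist_eq_norm] at heb
  have h1 := hF.norm_sq_le_neg_model_step hL hx
  have h2 := hF.model_step_add_le hL x (hF.ne_top_of_mem_optSet hxs)
  have h3 := add_inner_sub_le_of_lipschitz_gradient hF.differentiable hF.smooth x xs
  set m := model f g L x (step f g L x)
  have h4 : 0 ≤ L / 2 * ‖xs - step f g L x‖ ^ 2 := by positivity
  -- One `L / 2` comes from the model at `xs`, the other from the lower quadratic bound on `f`.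
  have h5 : realObjective f g x - realObjective f g x₀ ≤ -m + L * ‖xs - x‖ ^ 2 := by
    rw [hval]
    simp only [realObjective, model] at h2 ⊢
    linarith
  have h6 : ‖xs - x‖ ^ 2 ≤ L ^ 2 * μ ^ 2 * ‖x - step f g L x‖ ^ 2 := by
    refine (pow_le_pow_left₀ (norm_nonneg _) heb 2).trans_eq ?_
    ring
  have h7 : L * ‖xs - x‖ ^ 2 ≤ 2 * L ^ 2 * μ ^ 2 * -m := by
    have h8 := mul_le_mul_of_nonneg_left h6 hL.le
    have h9 := mul_le_mul_of_nonneg_left h1 (by positivity : 0 ≤ 2 * L ^ 2 * μ ^ 2)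
    linarith
  have hm : 0 ≤ -m := le_trans (by positivity) h1
  have h10 : 0 ≤ L ^ 2 * μ ^ 2 * -m := by positivity
  rw [div_mul_eq_mul_div, div_le_iff₀ (by positivity)]
  -- The estimates give `1 + 2 L² μ²`; `h10` supplies the slack up to the stated `4`.
  have h11 : realObjective f g x - realObjective f g x₀ ≤ -m * (1 + 4 * L ^ 2 * μ ^ 2) := by
    linarith
  have h12 := mul_le_mul_of_nonneg_left h11 hL.le
  linarith

/-! ### PL implies quadratic growth -/

/-- One proximal gradient step decreases the root of the optimality gap in proportion to its
length. -/
theorem mul_norm_step_le_sqrt_sub_sqrt (hF : Regularity f g L) (hL : 0 < L) (hα : L < α)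
    {ν : ℝ} (hν : 0 < ν) {xs : EuclideanSpace ℝ (Fin d)} (hxs : xs ∈ optSet f g) (hx : g x ≠ ⊤)
    (hPL : ν * (realObjective f g x - realObjective f g xs)
      ≤ -(L * model f g L x (step f g L x))) :
    √(ν * (1 - L / α) / 2) * ‖x - step f g α x‖
      ≤ √(realObjective f g x - realObjective f g xs)
        - √(realObjective f g (step f g α x) - realObjective f g xs) := by
  have hα0 : 0 < α := hL.trans hα
  have h1 := hF.mul_model_step_le hL hα.le hx
  have h2 := hF.realObjective_step_le x α
  have h3 := hF.norm_sq_le_neg_model_step hα0 hx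
  have h4 := hF.realObjective_le hxs (hF.step_ne_top hα0 x)
  have h5 := hF.realObjective_le hxs hx
  set a := -model f g α x (step f g α x) with ha
  set δ := ‖x - step f g α x‖ with hδ
  have hδ0 : 0 ≤ δ := norm_nonneg _
  obtain ⟨r, hr, hr2⟩ : ∃ r, 0 ≤ r ∧ r ^ 2 = realObjective f g x - realObjective f g xs :=
    ⟨_, Real.sqrt_nonneg _, Real.sq_sqrt (by linarith)⟩
  obtain ⟨s, hs, hs2⟩ : ∃ s, 0 ≤ s ∧
      s ^ 2 = realObjective f g (step f g α x) - realObjective f g xs :=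
    ⟨_, Real.sqrt_nonneg _, Real.sq_sqrt (by linarith)⟩
  have hfrac : 0 < 1 - L / α := sub_pos.2 ((div_lt_one hα0).2 hα)
  obtain ⟨c, hc, hc2⟩ : ∃ c, c = √(ν * (1 - L / α) / 2) ∧ c ^ 2 = ν * (1 - L / α) / 2 :=
    ⟨_, rfl, Real.sq_sqrt (by positivity)⟩
  have hc0 : 0 ≤ c := hc ▸ Real.sqrt_nonneg _
  rw [← hr2, ← hs2, Real.sqrt_sq hr, Real.sqrt_sq hs, ← hc]
  rw [← hr2] at hPL
  have hdec : a + (α - L) / 2 * δ ^ 2 ≤ r ^ 2 - s ^ 2 := by linarith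
  have hαa : ν * r ^ 2 ≤ α * a := by linarith
  have hαL : 0 < α - L := by linarith
  have hsr : s ≤ r := by
    refine le_of_abs_le (abs_le_of_sq_le_sq ?_ hr)
    have : 0 ≤ a := le_trans (by positivity) h3
    have : 0 ≤ (α - L) / 2 * δ ^ 2 := by positivity
    linarith
  -- AM-GM on the two parts of the decrease: PL gives `a ≥ ν r² / α`, so their product is at least
  -- `(c δ r)²`.
  have hprod : 2 * (c * δ * r) ≤ r ^ 2 - s ^ 2 := by
    refine le_trans ?_ hdec
    have hb : c ^ 2 * δ ^ 2 * r ^ 2 ≤ a * ((α - L) / 2 * δ ^ 2) := by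
      have h6 : c ^ 2 * δ ^ 2 * r ^ 2 = ν * r ^ 2 * ((α - L) / 2 * δ ^ 2 / α) := by
        rw [hc2]; field_simp
      have h7 := mul_le_mul_of_nonneg_right hαa
        (by positivity : 0 ≤ (α - L) / 2 * δ ^ 2 / α)
      rw [h6]
      refine h7.trans_eq ?_
      field_simp
    refine le_of_abs_le (abs_le_of_sq_le_sq ?_ ?_)
    · nlinarith [sq_nonneg (a - (α - L) / 2 * δ ^ 2)]
    · have : 0 ≤ a := le_trans (by positivity) h3
      positivity
  -- Dividing by `2 r` needs `r > 0`. If `r = 0`, the point is already optimal and the step has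
  -- length zero.
  rcases hr.eq_or_lt with h0 | hpos
  · have hs0 : s = 0 := le_antisymm (h0 ▸ hsr) hs
    have hδz : δ = 0 := by
      have h8 : α / 2 * δ ^ 2 ≤ 0 := by
        have : 0 ≤ (α - L) / 2 * δ ^ 2 := by positivity
        rw [← h0, hs0] at hdec
        linarith
      have h9 : δ ^ 2 ≤ 0 := by
        by_contra hcon
        have : 0 < α / 2 * δ ^ 2 := mul_pos (by positivity) (not_le.1 hcon)
        linarith
      exact pow_eq_zero_iff two_ne_zero |>.1 (le_antisymm h9 (sq_nonneg δ))
    rw [hδz, hs0, ← h0]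
    simp
  -- Since `s ≤ r`, `r ^ 2 - s ^ 2 ≤ (r - s) * (2 * r)`.
  · refine le_of_mul_le_mul_right (a := 2 * r) ?_ (by positivity)
    nlinarith

/-- Quadratic growth with a constant that loses a factor depending on the step size. -/
theorem mul_infDist_le_sqrt (hF : Regularity f g L) (hL : 0 < L) (hα : L < α)
    {K : Set (EuclideanSpace ℝ (Fin d))} {ν : ℝ} (hPL : RestrictedPL f g L K ν)
    (hK : ProxGradInvariant f g L K) {xs : EuclideanSpace ℝ (Fin d)} (hxs : xs ∈ optSet f g)
    (hxK : x ∈ K) (hx : g x ≠ ⊤) :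
    √(ν * (1 - L / α) / 2) * Metric.infDist x (optSet f g)
      ≤ √(realObjective f g x - realObjective f g xs) := by
  have hα0 : 0 < α := hL.trans hα
  obtain ⟨hν, hPL⟩ := (hF.restrictedPL_iff hL hxs).1 hPL
  set u : ℕ → EuclideanSpace ℝ (Fin d) := fun n => (step f g α)^[n] x with hu
  have husucc : ∀ n, u (n + 1) = step f g α (u n) := fun n => Function.iterate_succ_apply' _ n x
  have hstepK : ∀ z ∈ K, step f g α z ∈ K := fun z hz => by
    have h := hK (1 / α) ⟨by positivity, one_div_le_one_div_of_le hL hα.le⟩ hz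
    simpa only [sub_smul_gradMap (one_div_pos.2 hα0).ne', one_div_one_div] using h
  have huK : ∀ n, u n ∈ K ∧ g (u n) ≠ ⊤ := by
    intro n
    induction n with
    | zero => exact ⟨hxK, hx⟩
    | succ n ih => rw [husucc]; exact ⟨hstepK _ ih.1, hF.step_ne_top hα0 _⟩
  have hfrac : 0 < 1 - L / α := sub_pos.2 ((div_lt_one hα0).2 hα)
  obtain ⟨a, hlim, hdist⟩ := exists_tendsto_of_mul_dist_le_sub (u := u)
    (r := fun n => √(realObjective f g (u n) - realObjective f g xs))
    (c := √(ν * (1 - L / α) / 2)) (Real.sqrt_pos.2 (by positivity))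
    (fun n => Real.sqrt_nonneg _) (fun n => by
      rw [husucc, dist_eq_norm]
      exact hF.mul_norm_step_le_sqrt_sub_sqrt hL hα hν hxs (huK n).2
        (hPL _ (huK n).1 (huK n).2))
  set Δ : ℕ → ℝ := fun n => realObjective f g (u n) - realObjective f g xs with hΔ
  have hΔ0 : ∀ n, 0 ≤ Δ n := fun n => sub_nonneg.2 (hF.realObjective_le hxs (huK n).2)
  -- Finite length alone does not make the limit optimal; this decrease makes the gaps summable, so
  -- they tend to zero, and lower semicontinuity passes this to `a`.
  have hcontr : ∀ n, ν / α * Δ n ≤ Δ n - Δ (n + 1) := by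
    intro n
    have h1 := hF.mul_model_step_le hL hα.le (huK n).2
    have h2 := hF.realObjective_step_le (u n) α
    have h3 := hPL _ (huK n).1 (huK n).2
    have h4 : 0 ≤ (α - L) / 2 * ‖u n - step f g α (u n)‖ ^ 2 :=
      mul_nonneg (by linarith) (sq_nonneg _)
    rw [div_mul_eq_mul_div, div_le_iff₀ hα0]
    simp only [hΔ, husucc]
    have h5 : -model f g α (u n) (step f g α (u n))
        ≤ realObjective f g (u n) - realObjective f g (step f g α (u n)) := by linarith
    have h6 := mul_le_mul_of_nonneg_left h5 hα0.le
    linarith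
  have hsum : Summable Δ := by
    refine summable_of_sum_range_le (c := Δ 0 / (ν / α)) hΔ0 fun n => ?_
    rw [le_div_iff₀' (by positivity), Finset.mul_sum]
    refine (Finset.sum_le_sum fun i _ => hcontr i).trans ?_
    rw [Finset.sum_range_sub']
    linarith [hΔ0 n]
  have hval : Filter.Tendsto (fun n => objective f g (u n)) Filter.atTop
      (nhds (optValue f g)) := by
    have h1 := hsum.tendsto_atTop_zero.add_const (realObjective f g xs)
    rw [zero_add] at h1
    rw [hF.optValue_eq hxs]
    refine ((continuous_coe_real_ereal.tendsto _).comp h1).congr fun n => ?_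
    rw [hF.objective_eq (huK n).2]
    simp [hΔ]
  have haopt : a ∈ optSet f g := by
    have h1 : objective f g a ≤ optValue f g := by
      refine le_of_forall_lt fun b hb => ?_
      obtain ⟨b', hbb', hb'⟩ := exists_between hb
      have h2 := hlim.eventually (hF.lowerSemicontinuous_objective a b' hb')
      exact hbb'.trans_le (ge_of_tendsto hval (h2.mono fun n hn => hn.le))
    exact fun y => h1.trans (iInf_le _ y)
  exact (mul_le_mul_of_nonneg_left (Metric.infDist_le_dist_of_mem haopt)
    (Real.sqrt_nonneg _)).trans hdist

/-- Sharp quadratic growth on a set that is invariant under proximal gradient updates. -/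
theorem mul_infDist_sq_le (hF : Regularity f g L) (hL : 0 < L)
    {K : Set (EuclideanSpace ℝ (Fin d))} {ν : ℝ} (hPL : RestrictedPL f g L K ν)
    (hK : ProxGradInvariant f g L K) {xs : EuclideanSpace ℝ (Fin d)} (hxs : xs ∈ optSet f g)
    (hxK : x ∈ K) (hx : g x ≠ ⊤) :
    ν / 2 * Metric.infDist x (optSet f g) ^ 2
      ≤ realObjective f g x - realObjective f g xs := by
  have hν := hPL.1
  have key : ∀ α, L < α → ν * (1 - L / α) / 2 * Metric.infDist x (optSet f g) ^ 2
      ≤ realObjective f g x - realObjective f g xs := by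
    intro α hα
    have h := pow_le_pow_left₀ (mul_nonneg (Real.sqrt_nonneg _) Metric.infDist_nonneg)
      (hF.mul_infDist_le_sqrt hL hα hPL hK hxs hxK hx) 2
    have hfrac : 0 < 1 - L / α := sub_pos.2 ((div_lt_one (hL.trans hα)).2 hα)
    rwa [mul_pow, Real.sq_sqrt (by positivity),
      Real.sq_sqrt (sub_nonneg.2 (hF.realObjective_le hxs hx))] at h
  have hlim : Filter.Tendsto
      (fun α : ℝ => ν * (1 - L / α) / 2 * Metric.infDist x (optSet f g) ^ 2) Filter.atTop
      (nhds (ν * (1 - 0) / 2 * Metric.infDist x (optSet f g) ^ 2)) :=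
    ((((Filter.tendsto_id.const_div_atTop L).const_sub 1).const_mul ν).div_const 2).mul_const _
  rw [sub_zero, mul_one] at hlim
  exact le_of_tendsto hlim ((Filter.eventually_gt_atTop L).mono key)

/-! ### PL implies the error bound -/

/-- After a proximal gradient step, the minimal model value is controlled by the length of the
step just taken. -/
theorem neg_model_step_step_le (hF : Regularity f g L) (hL : 0 < L)
    (x : EuclideanSpace ℝ (Fin d)) :
    -(L * model f g L (step f g L x) (step f g L (step f g L x)))
      ≤ 2 * (L * ‖x - step f g L x‖) ^ 2 := by
  have h := hF.step_subgradient hL x (hF.step_ne_top hL (step f g L x))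
  set p := step f g L x
  set q := step f g L p
  have h1 : inner ℝ (gradient f x) (q - p) - inner ℝ (gradient f p) (q - p)
      ≤ L * ‖x - p‖ * ‖q - p‖ := by
    rw [← inner_sub_left]
    exact (real_inner_le_norm _ _).trans
      (mul_le_mul_of_nonneg_right (hF.smooth x p) (norm_nonneg _))
  have h2 : -(‖x - p‖ * ‖q - p‖) ≤ inner ℝ (x - p) (q - p) :=
    (abs_le.1 (abs_real_inner_le_norm _ _)).1
  have h3 := mul_le_mul_of_nonneg_left h2 hL.le
  have h4 : -model f g L p q ≤ 2 * L * ‖x - p‖ * ‖q - p‖ - L / 2 * ‖q - p‖ ^ 2 := by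
    simp only [model]
    linarith
  have h5 := mul_le_mul_of_nonneg_left h4 hL.le
  -- The bound in `h4` is a concave quadratic in `‖q - p‖`, maximal at `2‖x - p‖`.
  nlinarith [sq_nonneg (L * (‖q - p‖ - 2 * ‖x - p‖))]

/-- In the constant, `1 / L` pays for the step from `x` to `p` and `2 / ν` for the distance from `p`
to the minimizers. -/
theorem restrictedEB_of_restrictedPL (hF : Regularity f g L) (hL : 0 < L)
    {K : Set (EuclideanSpace ℝ (Fin d))} {ν : ℝ} (hPL : RestrictedPL f g L K ν)
    (hK : ProxGradInvariant f g L K) : RestrictedEB f g L K (1 / L + 2 / ν) := by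
  have hν := hPL.1
  refine ⟨by positivity, fun x hx => ?_⟩
  obtain ⟨xs, hxs⟩ := hF.optSet_nonempty
  have hpK : step f g L x ∈ K := by
    have h := hK (1 / L) ⟨by positivity, le_rfl⟩ hx.1
    simpa only [sub_smul_gradMap (one_div_pos.2 hL).ne', one_div_one_div] using h
  have hp := hF.step_ne_top hL x
  have h1 := hF.mul_infDist_sq_le hL hPL hK hxs hpK hp
  have h2 := ((hF.restrictedPL_iff hL hxs).1 hPL).2 _ hpK hp
  have h3 := hF.neg_model_step_step_le hL x
  have h4 := Metric.infDist_le_infDist_add_dist (s := optSet f g) (x := x) (y := step f g L x)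
  rw [norm_gradMap_one_div hL]
  rw [dist_eq_norm] at h4
  set D := Metric.infDist (step f g L x) (optSet f g)
  set δ := ‖x - step f g L x‖
  -- Growth and PL at `p` chain to `ν² D² / 2 ≤ ν · gap ≤ 2 (L δ)²`.
  have h5 : ν * D ≤ 2 * (L * δ) := by
    refine le_of_abs_le (abs_le_of_sq_le_sq ?_ (by positivity))
    have h6 := mul_le_mul_of_nonneg_left h1 hν.le
    nlinarith
  have h7 : D ≤ 2 / ν * (L * δ) := by
    rw [div_mul_eq_mul_div, le_div_iff₀' hν]
    exact h5
  have h8 : 1 / L * (L * δ) = δ := by field_simp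
  rw [add_mul, h8]
  linarith

end Regularity

end ProxPL

theorem mainTheorem1 {d : ℕ} (f : EuclideanSpace ℝ (Fin d) → ℝ)
    (g : EuclideanSpace ℝ (Fin d) → EReal) (L : ℝ) (hL : 0 < L)
    (hF : ProxPL.Regularity f g L) (K : Set (EuclideanSpace ℝ (Fin d))) :
    (∀ μ : ℝ, ProxPL.RestrictedEB f g L K μ →
      ProxPL.RestrictedPL f g L K (L / (1 + 4 * L ^ 2 * μ ^ 2))) ∧
    (∀ ν : ℝ, ProxPL.RestrictedPL f g L K ν →
      ProxPL.ProxGradInvariant f g L K → IsClosed K →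
      ProxPL.RestrictedEB f g L K (1 / L + 2 / ν)) :=
  ⟨fun _ hEB => hF.restrictedPL_of_restrictedEB hL hEB,
    fun _ hPL hK _ => hF.restrictedEB_of_restrictedPL hL hPL hK⟩
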